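/- Let $(K,v)$ be a valued field with completion $\widehat K$, and let $v$ be a valuation on the rational function field $\overline{\widehat K}(X)$ over an algebraic closure $\overline{\widehat K}$ of $\widehat K$, whose restriction to $\widehat K$ is (equivalent to) the valuation of the completion; all subfields carry the restricted valuation. Valuations are written additively, $vL=\{vx : x\in L^\times\}$ denotes the value group and $Lv$ the residue field of $(L,v)$. For $F=K$ or $F=\widehat K$, the extension $(F(X)|F,v)$ is called *valuation transcendental* if $\dim_{\mathbb Q}\big((vF(X)/vF)\otimes_{\mathbb Z}\mathbb Q\big)=1$ or $\operatorname{trdeg}[F(X)v:Fv]=1$, and *valuation algebraic* otherwise. If $(K(X)|K,v)$ is valuation algebraic, it is called *of type I* if $(\widehat K(X)|\widehat K,v)$ is valuation algebraic as well. **Theorem 1.4.** Assume that either $(K(X)|K,v)$ is valuation transcendental and $vK$ is cofinal in $vK(X)$, or $(K(X)|K,v)$ is valuation algebraic of type I. Then for every $\alpha\in v\widehat K(X)$ and all polynomials $f,g\in\widehat K[X]$ there exist polynomials $f',g'\in K[X]$ such that $$\deg f=\deg f',\quad \deg g=\deg g',\quad vf=vf',\quad vg=vg',\quad v(f-f')>\alpha,\quad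 v(g-g')>\alpha,$$ and, if $g\neq 0$, also $$v\Big(\frac fg-\frac{f'}{g'}\Big)>\alpha .$$ In particular, $K[X]$ is dense in $\widehat K[X]$ and $K(X)$ is dense in $\widehat K(X)$: for every $h\in\widehat K[X]$ (respectively $h\in\widehat K(X)$) and every $\gamma\in v\widehat K(X)$ there is $h'\in K[X]$ (respectively $h'\in K(X)$) with $v(h-h')>\gamma$. -/

import Mathlib

open Polynomial
open scoped TensorProduct

/-! Valuations are written multiplicatively, as in Mathlib: `Valuation.IsEquiv`, `v x ≤ 1`, etc.
The additive inequality "value of `x` greater than `α`" becomes `v x < α`, and the additive value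
`∞` of the element `0` becomes `0`. The value group `v E` of a valued field `(E, v)`, the set of all
`v x` with `x ≠ 0`, is `MonoidWithZeroHom.valueGroup (.ofClass v)`, a subgroup of the group of units
of the codomain of `v`. -/

namespace ValuedFieldExt

section General

universe u₁ u₂ u₃

variable (F : Type u₁) {E : Type u₂} {Γ : Type u₃} [Field F] [Field E] [Algebra F E]
  [LinearOrderedCommGroupWithZero Γ]

/-- The value group `v E` of a valued field `(E, v)`. -/
abbrev valGroup (v : Valuation E Γ) : Subgroup Γˣ :=
  MonoidWithZeroHom.valueGroup (.ofClass v)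

/-- Elements of the value group are exactly the values of the nonzero elements. -/
theorem mem_valGroup_iff (v : Valuation E Γ) (γ : Γˣ) :
    γ ∈ valGroup v ↔ ∃ x : E, x ≠ 0 ∧ v x = γ := by
  have h := MonoidWithZeroHom.valueGroup_eq_range (f := (MonoidWithZeroHom.ofClass v))
  have h2 : γ ∈ valGroup v ↔ (γ : Γ) ∈ Units.val '' (valGroup v : Set Γˣ) := by
    constructor
    · exact fun hγ => ⟨γ, hγ, rfl⟩
    · rintro ⟨δ, hδ, e⟩
      rwa [← Units.ext e]
  rw [h2, h]
  constructor
  · rintro ⟨⟨x, hx⟩, -⟩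
    refine ⟨x, ?_, hx⟩
    rintro rfl
    exact γ.ne_zero (hx.symm.trans (map_zero v))
  · rintro ⟨x, -, hx⟩
    exact ⟨⟨x, hx⟩, γ.ne_zero⟩

/-- The restriction to `F` of a valuation `v` on an extension field `E` of `F`. -/
abbrev restrictBase (v : Valuation E Γ) : Valuation F Γ :=
  v.comap (algebraMap F E)

instance (v : Valuation E Γ) : (restrictBase F v).HasExtension v :=
  ⟨Valuation.IsEquiv.refl⟩

/-- The rational rank of `vE / vF`: the dimension over `ℚ` of `(vE / vF) ⊗ ℚ`. -/
noncomputable def rationalRank (v : Valuation E Γ) : Cardinal :=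
  Module.rank ℚ
    (ℚ ⊗[ℤ] Additive (valGroup v ⧸ (valGroup (restrictBase F v)).subgroupOf (valGroup v)))

/-- The transcendence degree of the residue field extension `Ev | Fv`. -/
noncomputable def residueTrdeg (v : Valuation E Γ) : Cardinal :=
  Algebra.trdeg (IsLocalRing.ResidueField (restrictBase F v).valuationSubring)
    (IsLocalRing.ResidueField v.valuationSubring)

/-- `(E | F, v)` is value transcendental (used for `E = F(X)`). -/
def IsValueTranscendental (v : Valuation E Γ) : Prop :=
  rationalRank F v = 1

/-- `(E | F, v)` is residue transcendental (used for `E = F(X)`). -/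
def IsResidueTranscendental (v : Valuation E Γ) : Prop :=
  residueTrdeg F v = 1

/-- `(E | F, v)` is valuation transcendental (used for `E = F(X)`). -/
def IsValuationTranscendental (v : Valuation E Γ) : Prop :=
  IsValueTranscendental F v ∨ IsResidueTranscendental F v

/-- `(E | F, v)` is valuation algebraic (used for `E = F(X)`). -/
def IsValuationAlgebraic (v : Valuation E Γ) : Prop :=
  ¬ IsValuationTranscendental F v

/-- `vF` is cofinal in `vE`. In additive notation every element of `vE` is at most some element of
`vF`; the order is reversed in multiplicative notation. -/
def BaseCofinal (v : Valuation E Γ) : Prop :=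
  ∀ γ ∈ valGroup v, ∃ δ ∈ valGroup (restrictBase F v), δ ≤ γ

/-- The subset `S` of the valued field `(E, v)` is dense in the subset `T`: every element of `T` is
approximated by elements of `S` to within any prescribed element of the value group `vE`. -/
def IsDenseIn (v : Valuation E Γ) (S T : Set E) : Prop :=
  ∀ a ∈ T, ∀ γ ∈ valGroup v, ∃ b ∈ S, v (a - b) < γ

/-- The inclusion `F(X) → E(X)` induced by a field extension `E | F`. -/
noncomputable def ratFuncMap (F : Type u₁) (E : Type u₂) [Field F] [Field E] [Algebra F E] :
    RatFunc F →+* RatFunc E :=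
  RatFunc.mapRingHom (Polynomial.mapRingHom (algebraMap F E))
    (nonZeroDivisors_le_comap_nonZeroDivisors_of_injective _
      (Polynomial.map_injective _ (algebraMap F E).injective))

end General

section Completed

universe u₁ u₂ u₃

/-- `FieldCompletion K` is the completion of the valued field `K`, with the extended valuation
`(Valued.v : Valuation (FieldCompletion K) Γ₀)`. -/
abbrev FieldCompletion (K : Type u₁) {Γ₀ : Type u₂} [Field K] [LinearOrderedCommGroupWithZero Γ₀]
    [Valued K Γ₀] : Type u₁ :=
  UniformSpace.Completion K

/-- The algebraic closure of the completion of `K`. -/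
abbrev CompletionBar (K : Type u₁) {Γ₀ : Type u₂} [Field K] [LinearOrderedCommGroupWithZero Γ₀]
    [Valued K Γ₀] : Type u₁ :=
  AlgebraicClosure (FieldCompletion K)

variable {K : Type u₁} {Γ₀ : Type u₂} {Γ : Type u₃} [Field K]
  [LinearOrderedCommGroupWithZero Γ₀] [Valued K Γ₀] [LinearOrderedCommGroupWithZero Γ]

/-- The restriction to `FieldCompletion K (X)` of a valuation on `CompletionBar K (X)`. -/
noncomputable def onCompl (v : Valuation (RatFunc (CompletionBar K)) Γ) :
    Valuation (RatFunc (FieldCompletion K)) Γ :=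
  v.comap (ratFuncMap (FieldCompletion K) (CompletionBar K))

/-- The restriction to `K(X)` of a valuation on `CompletionBar K (X)`. -/
noncomputable def onBase (v : Valuation (RatFunc (CompletionBar K)) Γ) : Valuation (RatFunc K) Γ :=
  (onCompl v).comap (ratFuncMap K (FieldCompletion K))

/-- `(K(X) | K, v)` is valuation algebraic of type I: it is valuation algebraic and stays so after
passing to the completion of `K`, i.e. the extension induced on
`FieldCompletion K (X) | FieldCompletion K` is valuation algebraic too. -/
def IsValuationAlgebraicTypeI (v : Valuation (RatFunc (CompletionBar K)) Γ) : Prop :=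
  IsValuationAlgebraic K (onBase v) ∧ IsValuationAlgebraic (FieldCompletion K) (onCompl v)

/-- The inclusion of `K[X]` into the function field `FieldCompletion K (X)`. -/
noncomputable def ofPoly : K[X] →+* RatFunc (FieldCompletion K) :=
  (algebraMap (FieldCompletion K)[X] (RatFunc (FieldCompletion K))).comp
    (Polynomial.mapRingHom (algebraMap K (FieldCompletion K)))

/-- The inclusion of `FieldCompletion K [X]` into the function field `FieldCompletion K (X)`. -/
noncomputable def ofComplPoly : (FieldCompletion K)[X] →+* RatFunc (FieldCompletion K) :=
  algebraMap (FieldCompletion K)[X] (RatFunc (FieldCompletion K))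

end Completed

end ValuedFieldExt

open ValuedFieldExt

/-! Write F = K and E for its completion. The theorem follows from two facts about E(X): F is dense
in E, and the values of E are cofinal in those of E(X). Given these, a polynomial is approximated
coefficient by coefficient, with tolerances fine enough to preserve degree and value
(`exists_polynomial_map_eq_sub_lt`), and a common denominator handles quotients.

The work is cofinality. In type I, rational rank different from 1 means rank 0, because E(X) has
transcendence degree 1; every value is then torsion modulo the values of E. In the transcendental
case, suppose cofinality fails. Since F is cofinal in F(X), some nonzero f in E[X] is smaller than
every nonzero constant. For h = a/b in F(X) and n = deg f, the n + 1 products a^i b^(n-i) are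
linearly dependent modulo f, so a nonzero p over E has p(h) smaller than every nonzero constant
(`exists_isBeyondBase_aeval`). Hence the value of h is torsion modulo the values of F, and the
residue of an integral h is algebraic. Rational rank and residue transcendence degree both vanish, a
contradiction. -/

namespace ValuedFieldExt

/-! ### Ultrametric sums and torsion in tensor products -/

section Valuation

variable {R Γ : Type*} [Ring R] [LinearOrderedCommGroupWithZero Γ]

/-- If a sum has smaller value than one of its terms, then two of its nonzero terms have the same
value. -/
theorem exists_ne_map_eq_of_map_sum_lt (v : Valuation R Γ) {ι : Type*} {s : Finset ι} {a : ι → R}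
    {j : ι} (hj : j ∈ s) (h : v (∑ i ∈ s, a i) < v (a j)) :
    ∃ i ∈ s, ∃ k ∈ s, i ≠ k ∧ v (a i) = v (a k) ∧ v (a i) ≠ 0 := by
  classical
  obtain ⟨m, hm, hmax⟩ := s.exists_max_image (fun i => v (a i)) ⟨j, hj⟩
  have hjm : v (∑ i ∈ s, a i) < v (a m) := h.trans_le (hmax j hj)
  have hm0 : v (a m) ≠ 0 := (zero_le.trans_lt hjm).ne'
  by_contra! hne
  refine hjm.ne (v.map_sum_eq_of_lt hm fun i hi => ?_)
  rw [Finset.mem_sdiff, Finset.mem_singleton] at hi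
  refine lt_of_le_of_ne (hmax i hi.1) fun e => hm0 ?_
  rw [← e]
  exact hne i hi.1 m hm hi.2 e

end Valuation

/-- Tensoring with ℚ localizes at the nonzero integers, so its kernel is the torsion. -/
theorem one_tmul_eq_zero_iff {A : Type*} [AddCommGroup A] (a : A) :
    (1 : ℚ) ⊗ₜ[ℤ] a = 0 ↔ ∃ n : ℕ, n ≠ 0 ∧ n • a = 0 := by
  have hb : IsLocalizedModule (nonZeroDivisors ℤ) (TensorProduct.mk ℤ ℚ A 1) :=
    (isLocalizedModule_iff_isBaseChange (nonZeroDivisors ℤ) ℚ _).mpr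
      (TensorProduct.isBaseChange ℤ A ℚ)
  have h := IsLocalizedModule.eq_zero_iff (nonZeroDivisors ℤ) (TensorProduct.mk ℤ ℚ A 1) (m := a)
  rw [TensorProduct.mk_apply] at h
  rw [h]
  constructor
  · rintro ⟨⟨n, hn⟩, e⟩
    refine ⟨n.natAbs, Int.natAbs_ne_zero.mpr (nonZeroDivisors.ne_zero hn), ?_⟩
    have e' : n • a = 0 := e
    rcases Int.natAbs_eq n with h | h
    · rw [← natCast_zsmul, ← h, e']
    · rw [← natCast_zsmul, ← neg_eq_zero, ← neg_zsmul, ← h, e']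
  · rintro ⟨n, hn, e⟩
    refine ⟨⟨n, mem_nonZeroDivisors_of_ne_zero (by exact_mod_cast hn)⟩, ?_⟩
    change (n : ℤ) • a = 0
    rw [natCast_zsmul, e]

/-! ### Rational rank -/

section RationalRank

variable (F : Type*) {E Γ : Type*} [Field F] [Field E] [Algebra F E]
  [LinearOrderedCommGroupWithZero Γ] (v : Valuation E Γ)

/-- The class in `vE / vF` of the value of a nonzero element. -/
noncomputable def valClass :
    Eˣ →* valGroup v ⧸ (valGroup (restrictBase F v)).subgroupOf (valGroup v) :=
  (QuotientGroup.mk' _).comp ((Units.map (v : E →* Γ)).codRestrict (valGroup v)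
    fun y => (mem_valGroup_iff v _).mpr ⟨y, y.ne_zero, rfl⟩)

theorem valClass_surjective : Function.Surjective (valClass F v) := by
  intro q
  obtain ⟨⟨γ, hγ⟩, rfl⟩ := QuotientGroup.mk'_surjective _ q
  obtain ⟨y, hy, e⟩ := (mem_valGroup_iff v γ).mp hγ
  refine ⟨Units.mk0 y hy, ?_⟩
  refine congrArg _ (Subtype.ext (Units.ext ?_))
  exact e

theorem valClass_eq_one_iff (y : Eˣ) :
    valClass F v y = 1 ↔ ∃ x : F, v y = v (algebraMap F E x) := by
  have : valClass F v y = 1 ↔ Units.map (v : E →* Γ) y ∈ valGroup (restrictBase F v) := by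
    refine (QuotientGroup.eq_one_iff _).trans Iff.rfl
  rw [this, mem_valGroup_iff]
  constructor
  · rintro ⟨x, -, e⟩
    exact ⟨x, e.symm⟩
  · rintro ⟨x, e⟩
    refine ⟨x, ?_, e.symm⟩
    rintro rfl
    rw [map_zero, map_zero] at e
    exact y.ne_zero ((map_eq_zero v).mp e)

/-- The class in `(vE / vF) ⊗ ℚ` of the value of a nonzero element. -/
noncomputable def ratClass (y : Eˣ) :
    ℚ ⊗[ℤ] Additive (valGroup v ⧸ (valGroup (restrictBase F v)).subgroupOf (valGroup v)) :=
  1 ⊗ₜ Additive.ofMul (valClass F v y)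

theorem ratClass_mul (y z : Eˣ) : ratClass F v (y * z) = ratClass F v y + ratClass F v z := by
  rw [ratClass, map_mul, ofMul_mul, TensorProduct.tmul_add]; rfl

theorem ratClass_zpow (y : Eˣ) (n : ℤ) : ratClass F v (y ^ n) = (n : ℚ) • ratClass F v y := by
  rw [ratClass, ratClass, map_zpow, ofMul_zpow, Int.cast_smul_eq_zsmul]
  exact map_zsmul (TensorProduct.mk ℤ ℚ _ 1) n _

theorem ratClass_eq_zero_iff (y : Eˣ) :
    ratClass F v y = 0 ↔ ∃ n : ℕ, n ≠ 0 ∧ ∃ x : F, v y ^ n = v (algebraMap F E x) := by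
  rw [ratClass, one_tmul_eq_zero_iff]
  refine exists_congr fun n => and_congr_right fun _ => ?_
  rw [← ofMul_pow, ofMul_eq_zero, ← map_pow, valClass_eq_one_iff, Units.val_pow_eq_pow_val, map_pow]

/-- Each pure tensor is a rational multiple of some `ratClass`, since classes of field elements
exhaust the quotient; rank questions thus become questions about single elements. -/
theorem tensor_induction {P : ℚ ⊗[ℤ] Additive
      (valGroup v ⧸ (valGroup (restrictBase F v)).subgroupOf (valGroup v)) → Prop}
    (zero : P 0) (add : ∀ x y, P x → P y → P (x + y))
    (smul : ∀ (q : ℚ) y, P (q • ratClass F v y)) (x) : P x := by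
  induction x with
  | zero => exact zero
  | add x y hx hy => exact add x y hx hy
  | tmul q a =>
    obtain ⟨y, hy⟩ := valClass_surjective F v a.toMul
    have := smul q y
    rwa [ratClass, TensorProduct.smul_tmul', smul_eq_mul, mul_one, hy, ofMul_toMul] at this

variable {F v}

theorem rationalRank_eq_zero
    (h : ∀ y : E, y ≠ 0 → ∃ n : ℕ, n ≠ 0 ∧ ∃ x : F, v y ^ n = v (algebraMap F E x)) :
    rationalRank F v = 0 := by
  rw [rationalRank, rank_zero_iff_forall_zero]
  refine tensor_induction F v rfl ?_ ?_
  · rintro _ _ rfl rfl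
    exact add_zero 0
  · intro q y
    rw [(ratClass_eq_zero_iff F v y).mpr (h y y.ne_zero), smul_zero]

/-- The values of two algebraically dependent elements are rationally dependent modulo `vF`. -/
theorem exists_smul_ratClass_add_eq_zero {x y : Eˣ}
    (h : ¬ AlgebraicIndependent F ![(x : E), (y : E)]) :
    ∃ a b : ℤ, (a ≠ 0 ∨ b ≠ 0) ∧
      (a : ℚ) • ratClass F v x + (b : ℚ) • ratClass F v y = 0 := by
  rw [algebraicIndependent_iff] at h
  push Not at h
  obtain ⟨p, hp, hp0⟩ := h
  obtain ⟨j, hj⟩ := MvPolynomial.support_nonempty.mpr hp0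
  rw [MvPolynomial.aeval_def, MvPolynomial.eval₂_eq'] at hp
  simp only [Fin.prod_univ_two, Matrix.cons_val_zero, Matrix.cons_val_one] at hp
  have hterm : ∀ m ∈ p.support, v (algebraMap F E (p.coeff m) * (x ^ m 0 * y ^ m 1)) ≠ 0 := by
    intro m hm
    rw [MvPolynomial.mem_support_iff] at hm
    exact (v.ne_zero_iff).mpr (mul_ne_zero (by simpa using hm)
      (mul_ne_zero (pow_ne_zero _ x.ne_zero) (pow_ne_zero _ y.ne_zero)))
  -- The nonzero terms of p(x, y) sum to zero, so two distinct monomials share a value; their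
  -- exponent differences give the relation.
  obtain ⟨m, hm, m', hm', hne, e, -⟩ := exists_ne_map_eq_of_map_sum_lt v hj
    (by rw [hp, map_zero]; exact zero_lt_iff.mpr (hterm j hj))
  refine ⟨m 0 - m' 0, m 1 - m' 1, ?_, ?_⟩
  · by_contra! hc
    refine hne (Finsupp.ext fun i => ?_)
    fin_cases i
    · simpa [sub_eq_zero] using hc.1
    · simpa [sub_eq_zero] using hc.2
  · rw [← ratClass_zpow, ← ratClass_zpow, ← ratClass_mul, ratClass_eq_zero_iff]
    refine ⟨1, one_ne_zero, p.coeff m' / p.coeff m, ?_⟩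
    have hx : v x ≠ 0 := v.ne_zero_iff.mpr x.ne_zero
    have hy : v y ≠ 0 := v.ne_zero_iff.mpr y.ne_zero
    have hc : v (algebraMap F E (p.coeff m)) ≠ 0 := by
      rw [MvPolynomial.mem_support_iff] at hm
      simpa using hm
    simp only [map_mul, map_pow] at e
    simp only [pow_one, Units.val_mul, Units.val_zpow_eq_zpow_val, map_mul, map_zpow₀, map_div₀,
      zpow_sub₀ hx, zpow_sub₀ hy, zpow_natCast]
    field_simp
    rw [mul_comm, e, mul_comm]

/-- A rational rank different from one is zero, if the transcendence degree is at most one. -/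
theorem exists_pow_eq_of_rationalRank_ne_one (hE : ∀ x y : E, ¬ AlgebraicIndependent F ![x, y])
    (h : rationalRank F v ≠ 1) (y : E) (hy : y ≠ 0) :
    ∃ n : ℕ, n ≠ 0 ∧ ∃ x : F, v y ^ n = v (algebraMap F E x) := by
  rw [← Units.val_mk0 hy, ← ratClass_eq_zero_iff]
  set u := Units.mk0 y hy
  by_contra hu
  -- A nonzero class spans: any other class is rationally dependent on it.
  refine h (rank_eq_one (ratClass F v u) hu (tensor_induction F v ?_ ?_ ?_))
  · exact ⟨0, zero_smul _ _⟩
  · rintro _ _ ⟨r, rfl⟩ ⟨s, rfl⟩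
    exact ⟨r + s, add_smul _ _ _⟩
  · intro q z
    obtain ⟨a, b, hab, e⟩ := exists_smul_ratClass_add_eq_zero (v := v) (hE u z)
    have hb : (b : ℚ) ≠ 0 := by
      intro hb
      rw [hb, zero_smul, add_zero, smul_eq_zero, or_iff_left hu] at e
      simp_all
    refine ⟨q * (-a / b), ?_⟩
    rw [mul_smul, div_eq_inv_mul, mul_smul]
    congr 1
    rw [inv_smul_eq_iff₀ hb, neg_smul, eq_comm, ← add_eq_zero_iff_eq_neg, add_comm, e]

end RationalRank

/-! ### Residue transcendence degree -/

section Residue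

open IsLocalRing

variable {F E Γ : Type*} [Field F] [Field E] [Algebra F E]
  [LinearOrderedCommGroupWithZero Γ] {v : Valuation E Γ}

/-- The residue field extension is algebraic if every integral element satisfies, up to an error of
value less than one, a primitive integral polynomial. -/
theorem residueTrdeg_eq_zero
    (h : ∀ y : E, v y ≤ 1 → ∃ p : F[X], (∀ i, v (algebraMap F E (p.coeff i)) ≤ 1) ∧
      (∃ i, v (algebraMap F E (p.coeff i)) = 1) ∧ v (aeval y p) < 1) :
    residueTrdeg F v = 0 := by
  have : Algebra.IsAlgebraic (ResidueField (restrictBase F v).valuationSubring)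
      (ResidueField v.valuationSubring) := by
    refine ⟨fun t => ?_⟩
    obtain ⟨⟨y, hy⟩, rfl⟩ := residue_surjective t
    obtain ⟨p, hp, ⟨i, hi⟩, hpy⟩ := h y hy
    let A := (restrictBase F v).valuationSubring
    let B := v.valuationSubring
    have hA : p ∈ Polynomial.lifts (algebraMap A F) := by
      rw [Polynomial.lifts_iff_coeff_lifts]
      exact fun n => ⟨⟨p.coeff n, hp n⟩, rfl⟩
    obtain ⟨q, rfl⟩ := hA
    -- The reduction is nonzero thanks to the coefficient of value one, and it kills the residue of
    -- `y`.
    refine ⟨q.map (residue A), fun hq => ?_, ?_⟩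
    · have h0 : q.coeff i ∈ maximalIdeal A := by
        rw [← residue_eq_zero_iff, ← coeff_map, hq, coeff_zero]
      rw [Valuation.mem_maximalIdeal_iff] at h0
      rw [coe_mapRingHom, coeff_map] at hi
      exact h0.ne hi
    · have h1 : aeval (residue B ⟨y, hy⟩) (q.map (residue A)) =
          residue B (aeval (⟨y, hy⟩ : B) q) := by
        rw [aeval_def, eval₂_map, aeval_def, hom_eval₂]
        rfl
      refine h1.trans ?_
      rw [residue_eq_zero_iff, Valuation.mem_maximalIdeal_iff]
      have h2 : ((aeval (⟨y, hy⟩ : B) q : B) : E) = aeval y (mapRingHom (algebraMap A F) q) := by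
        rw [aeval_def, coe_mapRingHom, aeval_def, eval₂_map]
        exact hom_eval₂ q (algebraMap A B) B.subtype _
      rw [h2]
      exact hpy
  exact trdeg_eq_zero_iff.mpr this

end Residue

/-! ### Rational function fields and cofinality -/

section RatFunc

open Cardinal in
theorem not_algebraicIndependent_pair (F : Type*) [Field F] (x y : RatFunc F) :
    ¬ AlgebraicIndependent F ![x, y] := by
  intro h
  have h1 : Algebra.trdeg F (RatFunc F) = 1 := by
    have halg : Algebra.IsAlgebraic F[X] (RatFunc F) :=
      IsLocalization.isAlgebraic (RatFunc F) (nonZeroDivisors F[X])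
    have := trdeg_add_eq F F[X] (A := RatFunc F)
    rwa [trdeg_eq_zero_iff.mpr halg, Polynomial.trdeg_of_isDomain, add_zero, eq_comm] at this
  have h2 := h.lift_cardinalMk_le_trdeg
  rw [h1, Cardinal.mk_fin, Cardinal.lift_natCast, Cardinal.lift_one] at h2
  norm_cast at h2

variable {F E Γ : Type*} [Field F] [Field E] [Algebra F E] [LinearOrderedCommGroupWithZero Γ]

theorem ratFuncMap_algebraMap_polynomial (p : F[X]) :
    ratFuncMap F E (algebraMap F[X] (RatFunc F) p) =
      algebraMap E[X] (RatFunc E) (p.map (algebraMap F E)) := by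
  have := RatFunc.map_apply_div (Polynomial.mapRingHom (algebraMap F E))
    (nonZeroDivisors_le_comap_nonZeroDivisors_of_injective _
      (Polynomial.map_injective _ (algebraMap F E).injective)) p 1
  rw [map_one, map_one, div_one, map_one, div_one] at this
  exact this

theorem ratFuncMap_algebraMap (c : F) :
    ratFuncMap F E (algebraMap F (RatFunc F) c) =
      algebraMap E (RatFunc E) (algebraMap F E c) := by
  rw [IsScalarTower.algebraMap_apply F F[X] (RatFunc F), ratFuncMap_algebraMap_polynomial,
    IsScalarTower.algebraMap_apply E E[X] (RatFunc E), Polynomial.algebraMap_eq, map_C,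
    Polynomial.algebraMap_eq]

theorem ratFuncMap_aeval (h : RatFunc F) (p : F[X]) :
    ratFuncMap F E (aeval h p) = aeval (ratFuncMap F E h) (p.map (algebraMap F E)) := by
  rw [aeval_def, hom_eval₂, aeval_def, eval₂_map]
  congr 1
  ext c
  exact ratFuncMap_algebraMap c

variable (w : Valuation (RatFunc E) Γ)

theorem baseCofinal_iff {E' : Type*} [Field E'] [Algebra F E'] (v : Valuation E' Γ) :
    BaseCofinal F v ↔ ∀ y : E', y ≠ 0 → ∃ x : F, x ≠ 0 ∧ v (algebraMap F E' x) ≤ v y := by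
  constructor
  · intro h y hy
    obtain ⟨δ, hδ, hle⟩ := h (Units.mk0 (v y) (v.ne_zero_iff.mpr hy))
      ((mem_valGroup_iff v _).mpr ⟨y, hy, rfl⟩)
    obtain ⟨x, hx, e⟩ := (mem_valGroup_iff _ δ).mp hδ
    refine ⟨x, hx, ?_⟩
    have hle' : (δ : Γ) ≤ v y := hle
    rwa [← e] at hle'
  · intro h γ hγ
    obtain ⟨y, hy, e⟩ := (mem_valGroup_iff v γ).mp hγ
    obtain ⟨x, hx, hle⟩ := h y hy
    have hx' : restrictBase F v x ≠ 0 := (Valuation.ne_zero_iff _).mpr hx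
    refine ⟨Units.mk0 _ hx', (mem_valGroup_iff _ _).mpr ⟨x, hx, rfl⟩, ?_⟩
    rw [← Units.val_le_val, ← e]
    exact hle

/-- A rational rank different from one makes the base field cofinal. -/
theorem baseCofinal_of_rationalRank_ne_one (h : rationalRank E w ≠ 1) : BaseCofinal E w := by
  rw [baseCofinal_iff]
  intro y hy
  rcases le_total 1 (w y) with h1 | h1
  · exact ⟨1, one_ne_zero, by simpa using h1⟩
  obtain ⟨n, hn, x, e⟩ :=
    exists_pow_eq_of_rationalRank_ne_one (not_algebraicIndependent_pair E) h y hy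
  -- Below one, the n-th power lies under `w y` and is already a value of the base.
  refine ⟨x, ?_, e ▸ pow_le_of_le_one zero_le h1 hn⟩
  rintro rfl
  rw [map_zero, map_zero] at e
  exact hy (w.zero_iff.mp (eq_zero_of_pow_eq_zero e))

/-! ### Approximation of polynomials and quotients -/

variable (F) in
/-- The subfield `F` of the valued field `(E, w)` is dense. -/
def BaseDense : Prop :=
  ∀ x δ : E, δ ≠ 0 → ∃ c : F,
    w (algebraMap E _ (x - algebraMap F E c)) < w (algebraMap E _ δ)

variable {w}

theorem exists_map_le_of_ne_zero {R : Type*} [Ring R] (v : Valuation R Γ) {x y : R} (hx : x ≠ 0)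
    (hy : y ≠ 0) : ∃ z : R, z ≠ 0 ∧ v z ≤ v x ∧ v z ≤ v y := by
  rcases le_total (v x) (v y) with h | h
  · exact ⟨x, hx, le_rfl, h⟩
  · exact ⟨y, hy, h, le_rfl⟩

theorem BaseDense.exists_map_eq (hd : BaseDense F w) {x : E} (hx : x ≠ 0) :
    ∃ c : F, w (algebraMap E _ x) = w (algebraMap E _ (algebraMap F E c)) := by
  obtain ⟨c, hc⟩ := hd x x hx
  refine ⟨c, (Valuation.map_eq_of_sub_lt w ?_).symm⟩
  rwa [Valuation.map_sub_swap, ← map_sub]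

/-- Coefficientwise approximation of polynomials. -/
theorem BaseDense.exists_coeff_sub_lt (hd : BaseDense F w) (f : E[X]) (δ : ℕ → E)
    (hδ : ∀ i, δ i ≠ 0) :
    ∃ f' : F[X], f'.support = f.support ∧
      ∀ i, w (algebraMap E _ (f.coeff i - algebraMap F E (f'.coeff i))) <
        w (algebraMap E _ (δ i)) := by
  have key : ∀ i, ∃ c : F, (c = 0 ↔ f.coeff i = 0) ∧
      w (algebraMap E _ (f.coeff i - algebraMap F E c)) < w (algebraMap E _ (δ i)) := by
    intro i
    by_cases h0 : f.coeff i = 0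
    · refine ⟨0, by simp [h0], ?_⟩
      rw [h0, map_zero, sub_zero, map_zero, map_zero]
      exact zero_lt_iff.mpr (by simpa using hδ i)
    · obtain ⟨z, hz, h1, h2⟩ :=
        exists_map_le_of_ne_zero (w.comap (algebraMap E (RatFunc E))) (hδ i) h0
      obtain ⟨c, hc⟩ := hd (f.coeff i) z hz
      refine ⟨c, ⟨?_, fun h => absurd h h0⟩, hc.trans_le h1⟩
      rintro rfl
      rw [map_zero, sub_zero] at hc
      exact absurd h2 hc.not_ge
  choose c hc0 hc using key
  have hcoeff : ∀ i, (∑ i ∈ f.support, monomial i (c i)).coeff i = c i := by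
    intro i
    simp only [finsetSum_coeff, coeff_monomial, Finset.sum_ite_eq', mem_support_iff]
    split_ifs with h
    · rfl
    · exact ((hc0 i).mpr (notMem_support_iff.mp h)).symm
  refine ⟨∑ i ∈ f.support, monomial i (c i), ?_, fun i => by rw [hcoeff]; exact hc i⟩
  ext i
  rw [mem_support_iff, mem_support_iff, hcoeff, not_iff_not, hc0]

theorem map_algebraMap_polynomial_lt {r : E[X]} {g : Γ} (hg : 0 < g)
    (h : ∀ i, w (algebraMap E _ (r.coeff i)) * w RatFunc.X ^ i < g) :
    w (algebraMap E[X] _ r) < g := by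
  rw [r.as_sum_support_C_mul_X_pow, map_sum]
  refine w.map_sum_lt' hg fun i _ => ?_
  rw [map_mul, map_pow, RatFunc.algebraMap_X, map_mul, map_pow, RatFunc.algebraMap_C]
  exact h i

theorem exists_polynomial_degree_eq_sub_lt (hd : BaseDense F w) (hcof : BaseCofinal E w) (f : E[X])
    {y : RatFunc E} (hy : y ≠ 0) :
    ∃ f' : F[X], f.degree = f'.degree ∧
      w (algebraMap E[X] _ f - algebraMap E[X] _ (f'.map (algebraMap F E))) < w y := by
  rw [baseCofinal_iff] at hcof
  -- The i-th coefficient is multiplied by `X ^ i`, so its tolerance must lie under `y / X ^ i`;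
  -- cofinality supplies a constant there.
  choose δ hδ hle using fun i : ℕ => hcof (y / RatFunc.X ^ i)
    (div_ne_zero hy (pow_ne_zero i RatFunc.X_ne_zero))
  obtain ⟨f', hs, hf'⟩ := hd.exists_coeff_sub_lt f δ hδ
  refine ⟨f', by rw [degree, degree, hs], ?_⟩
  rw [← map_sub]
  refine map_algebraMap_polynomial_lt (zero_lt_iff.mpr (w.ne_zero_iff.mpr hy)) fun i => ?_
  have hX : 0 < w RatFunc.X ^ i :=
    zero_lt_iff.mpr (pow_ne_zero i (w.ne_zero_iff.mpr RatFunc.X_ne_zero))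
  have h1 := (hf' i).trans_le (hle i)
  rwa [map_div₀, map_pow, lt_div_iff₀ hX, ← coeff_map, ← coeff_sub] at h1

/-- Polynomials are approximated by polynomials of the same degree and value. -/
theorem exists_polynomial_map_eq_sub_lt (hd : BaseDense F w) (hcof : BaseCofinal E w) (f : E[X])
    {y : RatFunc E} (hy : y ≠ 0) :
    ∃ f' : F[X], f.degree = f'.degree ∧
      w (algebraMap E[X] _ f) = w (algebraMap E[X] _ (f'.map (algebraMap F E))) ∧
      w (algebraMap E[X] _ f - algebraMap E[X] _ (f'.map (algebraMap F E))) < w y := by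
  rcases eq_or_ne f 0 with rfl | hf
  · refine ⟨0, by simp, by simp, ?_⟩
    simpa [zero_lt_iff] using hy
  obtain ⟨z, hz, hzy, hzf⟩ := exists_map_le_of_ne_zero w hy (RatFunc.algebraMap_ne_zero hf)
  obtain ⟨f', hdeg, hlt⟩ := exists_polynomial_degree_eq_sub_lt hd hcof f hz
  refine ⟨f', hdeg, (Valuation.map_eq_of_sub_lt w ?_).symm, hlt.trans_le hzy⟩
  rw [Valuation.map_sub_swap]
  exact hlt.trans_le hzf

/-- Over the common denominator g g', of value v(g)², the numerator is g(f - f') - f(g - g'). -/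
theorem div_sub_div_lt {L : Type*} [Field L] (v : Valuation L Γ) {f g f' g' y : L} (hg : g ≠ 0)
    (hgg' : v g = v g') (h1 : v (f - f') < v (y * g)) (h2 : v (f * (g - g')) < v (y * g ^ 2)) :
    v (f / g - f' / g') < v y := by
  have hg' : g' ≠ 0 := by rw [← v.ne_zero_iff, ← hgg']; exact v.ne_zero_iff.mpr hg
  have hpos : 0 < v g := zero_lt_iff.mpr (v.ne_zero_iff.mpr hg)
  have e : f / g - f' / g' = (g * (f - f') - f * (g - g')) / (g * g') := by
    field_simp
    ring
  rw [e, map_div₀, map_mul v g g', ← hgg', div_lt_iff₀ (mul_pos hpos hpos)]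
  refine (v.map_sub _ _).trans_lt (max_lt ?_ ?_)
  · rw [map_mul] at h1 ⊢
    rw [← mul_assoc, mul_comm]
    exact mul_lt_mul_of_pos_right h1 hpos
  · rwa [map_mul v y, map_pow, pow_two] at h2

theorem exists_polynomial_pair_approx (hd : BaseDense F w) (hcof : BaseCofinal E w) (f g : E[X])
    {y : RatFunc E} (hy : y ≠ 0) :
    ∃ f' g' : F[X], f.degree = f'.degree ∧ g.degree = g'.degree ∧
      w (algebraMap E[X] _ f) = w (algebraMap E[X] _ (f'.map (algebraMap F E))) ∧
      w (algebraMap E[X] _ g) = w (algebraMap E[X] _ (g'.map (algebraMap F E))) ∧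
      w (algebraMap E[X] _ f - algebraMap E[X] _ (f'.map (algebraMap F E))) < w y ∧
      w (algebraMap E[X] _ g - algebraMap E[X] _ (g'.map (algebraMap F E))) < w y ∧
      (g ≠ 0 → w (algebraMap E[X] _ f / algebraMap E[X] _ g -
        algebraMap E[X] _ (f'.map (algebraMap F E)) / algebraMap E[X] _ (g'.map (algebraMap F E)))
          < w y) := by
  rcases eq_or_ne g 0 with rfl | hg
  · obtain ⟨f', h1, h2, h3⟩ := exists_polynomial_map_eq_sub_lt hd hcof f hy
    exact ⟨f', 0, h1, by simp, h2, by simp, h3, by simpa [zero_lt_iff] using hy, by simp⟩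
  have hG := RatFunc.algebraMap_ne_zero hg
  obtain ⟨z, hz, hzy, hzg⟩ := exists_map_le_of_ne_zero w hy (mul_ne_zero hy hG)
  obtain ⟨f', h1, h2, h3⟩ := exists_polynomial_map_eq_sub_lt hd hcof f hz
  have hg2 : y * algebraMap E[X] _ g ^ 2 ≠ 0 := mul_ne_zero hy (pow_ne_zero 2 hG)
  -- For f ≠ 0 the tolerance for g is y g² / f; for f = 0 that quotient would be 0, but the term f(g
  -- - g') vanishes.
  rcases eq_or_ne f 0 with rfl | hf
  · obtain ⟨g', k1, k2, k3⟩ := exists_polynomial_map_eq_sub_lt hd hcof g hy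
    refine ⟨f', g', h1, k1, h2, k2, h3.trans_le hzy, k3, fun _ => ?_⟩
    refine div_sub_div_lt w hG k2 (h3.trans_le hzg) ?_
    rw [map_zero, zero_mul, map_zero]
    exact zero_lt_iff.mpr (w.ne_zero_iff.mpr hg2)
  have hF := RatFunc.algebraMap_ne_zero hf
  obtain ⟨t, ht, hty, htg⟩ := exists_map_le_of_ne_zero w hy (div_ne_zero hg2 hF)
  obtain ⟨g', k1, k2, k3⟩ := exists_polynomial_map_eq_sub_lt hd hcof g ht
  refine ⟨f', g', h1, k1, h2, k2, h3.trans_le hzy, k3.trans_le hty, fun _ => ?_⟩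
  refine div_sub_div_lt w hG k2 (h3.trans_le hzg) ?_
  have := k3.trans_le htg
  rwa [map_div₀, lt_div_iff₀ (zero_lt_iff.mpr (w.ne_zero_iff.mpr hF)), mul_comm, ← map_mul] at this

/-! ### Elements beyond the base field and failure of cofinality -/

/-- The value of `z` lies beyond the values of the base field. -/
def IsBeyondBase (w : Valuation (RatFunc E) Γ) (z : RatFunc E) : Prop :=
  ∀ x : E, x ≠ 0 → w z < w (algebraMap E _ x)

theorem IsBeyondBase.mul {z t : RatFunc E} (hz : IsBeyondBase w z) {d : E} (hd : d ≠ 0)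
    (ht : w t ≤ w (algebraMap E _ d)) : IsBeyondBase w (z * t) := by
  intro x hx
  have hd' : 0 < w (algebraMap E (RatFunc E) d) := zero_lt_iff.mpr (by simpa using hd)
  have h := hz (x / d) (div_ne_zero hx hd)
  rw [map_div₀, map_div₀, lt_div_iff₀ hd'] at h
  rw [map_mul]
  exact (mul_le_mul_right ht _).trans_lt h

theorem IsBeyondBase.div {z t : RatFunc E} (hz : IsBeyondBase w z) {d : E} (hd : d ≠ 0)
    (ht : w (algebraMap E _ d) ≤ w t) : IsBeyondBase w (z / t) := by
  rw [div_eq_mul_inv]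
  refine hz.mul (inv_ne_zero hd) ?_
  have hd' : 0 < w (algebraMap E (RatFunc E) d) := zero_lt_iff.mpr (by simpa using hd)
  rw [map_inv₀, map_inv₀, map_inv₀]
  exact inv_anti₀ hd' ht

theorem exists_le_of_baseCofinal_comap (hu : BaseCofinal F (w.comap (ratFuncMap F E)))
    {h : RatFunc F} (hh : h ≠ 0) :
    ∃ d : E, d ≠ 0 ∧ w (algebraMap E _ d) ≤ w (ratFuncMap F E h) := by
  rw [baseCofinal_iff] at hu
  obtain ⟨x, hx, hle⟩ := hu h hh
  refine ⟨algebraMap F E x, by simpa using hx, ?_⟩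
  rwa [Valuation.comap_apply, Valuation.comap_apply, ratFuncMap_algebraMap] at hle

/-- Cofinality applied to `X⁻¹` bounds the value of `X` above by a constant, hence that of every
monomial and every sum. -/
theorem exists_polynomial_map_le (hu : BaseCofinal F (w.comap (ratFuncMap F E))) (g : E[X]) :
    ∃ d : E, d ≠ 0 ∧ w (algebraMap E[X] _ g) ≤ w (algebraMap E _ d) := by
  obtain ⟨x, hx, hle⟩ := exists_le_of_baseCofinal_comap hu (inv_ne_zero (RatFunc.X_ne_zero (K := F)))
  have hxpos : 0 < w (algebraMap E (RatFunc E) x) := zero_lt_iff.mpr (by simpa using hx)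
  have hX : w RatFunc.X ≤ w (algebraMap E _ x⁻¹) := by
    rw [map_inv₀, ← RatFunc.algebraMap_X, ratFuncMap_algebraMap_polynomial, map_X,
      RatFunc.algebraMap_X, map_inv₀] at hle
    rw [map_inv₀, map_inv₀]
    exact (le_inv_comm₀ hxpos (zero_lt_iff.mpr (w.ne_zero_iff.mpr RatFunc.X_ne_zero))).mp hle
  induction g using Polynomial.induction_on' with
  | add p q hp hq =>
    obtain ⟨d, hd, hpd⟩ := hp
    obtain ⟨e, he, hqe⟩ := hq
    rw [map_add]
    rcases le_total (w (algebraMap E _ d)) (w (algebraMap E _ e)) with h | h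
    · exact ⟨e, he, w.map_add_le (hpd.trans h) hqe⟩
    · exact ⟨d, hd, w.map_add_le hpd (hqe.trans h)⟩
  | monomial n a =>
    rcases eq_or_ne a 0 with rfl | ha
    · exact ⟨1, one_ne_zero, by simp⟩
    refine ⟨a * x⁻¹ ^ n, mul_ne_zero ha (pow_ne_zero n (inv_ne_zero hx)), ?_⟩
    rw [← C_mul_X_pow_eq_monomial, map_mul, map_pow, RatFunc.algebraMap_X, map_mul, map_mul, map_mul,
      map_pow, map_pow, map_pow, RatFunc.algebraMap_C]
    exact mul_le_mul_right (pow_le_pow_left₀ zero_le hX n) _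

/-- Clear the denominator of a witness against cofinality: denominators are bounded above by
constants. -/
theorem exists_isBeyondBase_polynomial (hu : BaseCofinal F (w.comap (ratFuncMap F E)))
    (hw : ¬ BaseCofinal E w) : ∃ f : E[X], f ≠ 0 ∧ IsBeyondBase w (algebraMap E[X] _ f) := by
  rw [baseCofinal_iff] at hw
  push Not at hw
  obtain ⟨y, hy, hlt⟩ := hw
  obtain ⟨d, hd, hle⟩ := exists_polynomial_map_le hu y.denom
  refine ⟨y.num, y.num_ne_zero hy, ?_⟩
  have e : algebraMap E[X] _ y.num = y * algebraMap E[X] _ y.denom := by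
    rw [← div_eq_iff (RatFunc.algebraMap_ne_zero y.denom_ne_zero), RatFunc.num_div_denom]
  rw [e]
  exact IsBeyondBase.mul hlt hd hle

/-- The quotient E[X]/(f) has dimension deg f, one less than the number of products. They are
homogeneous so that dividing by a power of b yields a polynomial in a/b. -/
theorem exists_dvd_sum_mul_pow {f : E[X]} (hf : f ≠ 0) (a b : E[X]) :
    ∃ c : Fin (f.natDegree + 1) → E, (∃ i, c i ≠ 0) ∧
      f ∣ ∑ i, C (c i) * (a ^ (i : ℕ) * b ^ (f.natDegree - i)) := by
  have hfin : Module.finrank E (AdjoinRoot f) = f.natDegree := (AdjoinRoot.powerBasis hf).finrank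
  have : Module.Finite E (AdjoinRoot f) := (AdjoinRoot.powerBasis hf).finite
  have hdep : ¬ LinearIndependent E fun i : Fin (f.natDegree + 1) =>
      AdjoinRoot.mk f (a ^ (i : ℕ) * b ^ (f.natDegree - i)) := by
    intro h
    have := h.fintype_card_le_finrank
    rw [hfin, Fintype.card_fin] at this
    omega
  obtain ⟨c, hc, hi⟩ := Fintype.not_linearIndependent_iff.mp hdep
  refine ⟨c, hi, AdjoinRoot.mk_eq_zero.mp ?_⟩
  rw [map_sum, ← hc]
  refine Finset.sum_congr rfl fun i _ => ?_
  rw [map_mul, Algebra.smul_def]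
  rfl

/-- Every element of `F(X)` is a root of a nonzero polynomial over `E`, up to an error whose value
lies beyond the base field. -/
theorem exists_isBeyondBase_aeval (hu : BaseCofinal F (w.comap (ratFuncMap F E)))
    (hw : ¬ BaseCofinal E w) (h : RatFunc F) :
    ∃ p : E[X], p ≠ 0 ∧ IsBeyondBase w (aeval (ratFuncMap F E h) p) := by
  obtain ⟨f, hf, hfw⟩ := exists_isBeyondBase_polynomial hu hw
  obtain ⟨c, ⟨j, hj⟩, q, hq⟩ := exists_dvd_sum_mul_pow hf (h.num.map (algebraMap F E))
    (h.denom.map (algebraMap F E))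
  set b := algebraMap E[X] (RatFunc E) (h.denom.map (algebraMap F E)) with hb
  have hb0 : algebraMap F[X] (RatFunc F) h.denom ^ f.natDegree ≠ 0 :=
    pow_ne_zero _ (RatFunc.algebraMap_ne_zero h.denom_ne_zero)
  obtain ⟨d, hd, hdle⟩ := exists_le_of_baseCofinal_comap hu hb0
  obtain ⟨e, he, hele⟩ := exists_polynomial_map_le hu q
  rw [map_pow, ratFuncMap_algebraMap_polynomial, ← hb] at hdle
  have hbne : b ≠ 0 := RatFunc.algebraMap_ne_zero
    ((Polynomial.map_ne_zero_iff (algebraMap F E).injective).mpr h.denom_ne_zero)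
  have hh : ratFuncMap F E h = algebraMap E[X] _ (h.num.map (algebraMap F E)) / b := by
    rw [hb, ← ratFuncMap_algebraMap_polynomial, ← ratFuncMap_algebraMap_polynomial, ← map_div₀,
      RatFunc.num_div_denom]
  refine ⟨∑ i : Fin (f.natDegree + 1), monomial (i : ℕ) (c i), fun h0 => hj ?_, ?_⟩
  · have := congrArg (fun r => r.coeff j) h0
    simpa [finsetSum_coeff, coeff_monomial, Fin.val_inj] using this
  -- Here p(h) = f q / b^n, with `q` bounded above and b^n below by constants.
  · convert! (hfw.mul he hele).div hd hdle using 2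
    rw [eq_div_iff (pow_ne_zero _ hbne), ← map_mul, ← hq, map_sum, map_sum, Finset.sum_mul]
    refine Finset.sum_congr rfl fun i _ => ?_
    rw [aeval_monomial, hh, map_mul, map_mul, map_pow, map_pow, ← hb, RatFunc.algebraMap_C,
      ← pow_sub_mul_pow b (Nat.lt_succ_iff.mp i.2), div_pow]
    have := pow_ne_zero i hbne
    field_simp
    exact mul_comm _ _

/-- As p(h) is smaller than its leading term, two terms of degrees i < k share a value, so h^(k-i)
has the value of a ratio of coefficients; density moves that value into F. -/
theorem rationalRank_eq_zero_of_not_baseCofinal (hd : BaseDense F w)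
    (hu : BaseCofinal F (w.comap (ratFuncMap F E))) (hw : ¬ BaseCofinal E w) :
    rationalRank F (w.comap (ratFuncMap F E)) = 0 := by
  refine rationalRank_eq_zero fun h hh => ?_
  obtain ⟨p, hp, hpw⟩ := exists_isBeyondBase_aeval hu hw h
  set t := ratFuncMap F E h with ht
  have ht0 : w t ≠ 0 := w.ne_zero_iff.mpr ((_root_.map_ne_zero _).mpr hh)
  rw [aeval_eq_sum_range' (Nat.lt_succ_self _)] at hpw
  obtain ⟨d, hd0, hdle⟩ := exists_le_of_baseCofinal_comap hu (pow_ne_zero p.natDegree hh)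
  rw [map_pow, ← ht] at hdle
  have hlt : w (∑ i ∈ Finset.range (p.natDegree + 1), p.coeff i • t ^ i) <
      w (p.coeff p.natDegree • t ^ p.natDegree) := by
    refine (hpw (p.leadingCoeff * d)
      (mul_ne_zero (leadingCoeff_ne_zero.mpr hp) hd0)).trans_le ?_
    rw [Algebra.smul_def, map_mul, map_mul, map_mul]
    exact mul_le_mul_right hdle _
  obtain ⟨i, -, k, -, hik, e, h0⟩ := exists_ne_map_eq_of_map_sum_lt w
    (Finset.self_mem_range_succ p.natDegree) hlt
  wlog hlt' : i < k generalizing i k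
  · exact this k i hik.symm e.symm (e ▸ h0) (lt_of_le_of_ne (not_lt.mp hlt') hik.symm)
  have hk0 := e ▸ h0
  simp only [Algebra.smul_def, map_mul, map_pow] at e h0 hk0
  have hci := left_ne_zero_of_mul h0
  have hck := left_ne_zero_of_mul hk0
  have hq : p.coeff i / p.coeff k ≠ 0 :=
    div_ne_zero (by simpa using hci) (by simpa using hck)
  obtain ⟨x, hx⟩ := hd.exists_map_eq hq
  refine ⟨k - i, (Nat.sub_pos_of_lt hlt').ne', x, ?_⟩
  rw [Valuation.comap_apply, Valuation.comap_apply, ratFuncMap_algebraMap, ← hx, map_div₀, map_div₀,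
    eq_div_iff hck, ← ht]
  rw [← pow_sub_mul_pow _ hlt'.le, ← mul_assoc] at e
  rw [mul_comm]
  exact (mul_right_cancel₀ (pow_ne_zero _ ht0) e).symm

/-- Scale p so that its largest coefficient is 1; its value at h stays below one. Since h is
integral, replacing the coefficients by elements of F with errors below one keeps it so. -/
theorem residueTrdeg_eq_zero_of_not_baseCofinal (hd : BaseDense F w)
    (hu : BaseCofinal F (w.comap (ratFuncMap F E))) (hw : ¬ BaseCofinal E w) :
    residueTrdeg F (w.comap (ratFuncMap F E)) = 0 := by
  refine residueTrdeg_eq_zero fun h hh => ?_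
  obtain ⟨p, hp, hpw⟩ := exists_isBeyondBase_aeval hu hw h
  simp only [Valuation.comap_apply, ratFuncMap_algebraMap, ratFuncMap_aeval] at hh ⊢
  set t := ratFuncMap F E h
  obtain ⟨j, hj, hmax⟩ := p.support.exists_max_image
    (fun i => w (algebraMap E _ (p.coeff i))) (support_nonempty.mpr hp)
  have hj0 : p.coeff j ≠ 0 := mem_support_iff.mp hj
  have hjpos : 0 < w (algebraMap E (RatFunc E) (p.coeff j)) := zero_lt_iff.mpr (by simpa using hj0)
  set r := C (p.coeff j)⁻¹ * p with hr
  have hr1 : ∀ i, w (algebraMap E _ (r.coeff i)) ≤ 1 := by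
    intro i
    rw [hr, coeff_C_mul, inv_mul_eq_div, map_div₀, map_div₀, div_le_one₀ hjpos]
    by_cases hi : i ∈ p.support
    · exact hmax i hi
    · rw [notMem_support_iff.mp hi, map_zero, map_zero]
      exact zero_le
  have hrj : r.coeff j = 1 := by rw [hr, coeff_C_mul, inv_mul_cancel₀ hj0]
  have hrt : w (aeval t r) < 1 := by
    rw [hr, map_mul, aeval_C, map_mul, map_inv₀, map_inv₀, inv_mul_lt_one₀ hjpos]
    exact hpw _ hj0
  obtain ⟨q, -, hq⟩ := hd.exists_coeff_sub_lt r (fun _ => 1) fun _ => one_ne_zero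
  simp only [map_one] at hq
  refine ⟨q, fun i => ?_, ⟨j, ?_⟩, ?_⟩
  · rw [← sub_sub_cancel (r.coeff i) (algebraMap F E (q.coeff i)), map_sub]
    exact w.map_sub_le (hr1 i) (hq i).le
  · have := hq j
    rw [hrj, map_sub, map_one, Valuation.map_sub_swap] at this
    exact (w.map_eq_of_sub_lt (this.trans_eq w.map_one.symm)).trans w.map_one
  · have hdiff : w (aeval t (r - q.map (algebraMap F E))) < 1 := by
      rw [aeval_eq_sum_range]
      refine w.map_sum_lt' zero_lt_one fun i _ => ?_
      rw [Algebra.smul_def, map_mul, map_pow, coeff_sub, coeff_map]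
      exact mul_lt_one_of_lt_of_le (hq i) (pow_le_one₀ zero_le hh)
    rw [← sub_sub_cancel r (q.map (algebraMap F E)), map_sub]
    exact w.map_sub_lt hrt hdiff

theorem baseCofinal_of_isValuationTranscendental (hd : BaseDense F w)
    (hu : BaseCofinal F (w.comap (ratFuncMap F E)))
    (ht : IsValuationTranscendental F (w.comap (ratFuncMap F E))) : BaseCofinal E w := by
  by_contra hw
  rcases ht with ht | ht
  · exact zero_ne_one ((rationalRank_eq_zero_of_not_baseCofinal hd hu hw).symm.trans ht)
  · exact zero_ne_one ((residueTrdeg_eq_zero_of_not_baseCofinal hd hu hw).symm.trans ht)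

end RatFunc

/-! ### The completion -/

section Completed

variable {K Γ₀ Γ : Type*} [Field K] [LinearOrderedCommGroupWithZero Γ₀] [Valued K Γ₀]
  [LinearOrderedCommGroupWithZero Γ]

theorem exists_completion_sub_lt (x δ : FieldCompletion K) (hδ : δ ≠ 0) :
    ∃ c : K, (Valued.v : Valuation (FieldCompletion K) Γ₀) (x - algebraMap K _ c) <
      Valued.v δ := by
  have hδ' : (Valued.v : Valuation (FieldCompletion K) Γ₀).restrict δ ≠ 0 :=
    (Valuation.ne_zero_iff _).mpr hδ
  have hmem : {y : FieldCompletion K | (Valued.v : Valuation (FieldCompletion K) Γ₀).restrict (y - x)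
      < (Valued.v : Valuation (FieldCompletion K) Γ₀).restrict δ} ∈ nhds x :=
    Valued.mem_nhds.mpr ⟨Units.mk0 _ hδ', fun _ hy => hy⟩
  obtain ⟨c, hc⟩ := UniformSpace.Completion.denseRange_coe.exists_mem_open isOpen_interior
    ⟨x, mem_interior_iff_mem_nhds.mpr hmem⟩
  refine ⟨c, ?_⟩
  have := interior_subset hc
  rw [Valuation.map_sub_swap]
  exact (Valuation.restrict_lt_iff _).mp this

theorem onCompl_algebraMap (v : Valuation (RatFunc (CompletionBar K)) Γ) (x : FieldCompletion K) :
    onCompl v (algebraMap _ (RatFunc (FieldCompletion K)) x) =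
      v (algebraMap (FieldCompletion K) (RatFunc (CompletionBar K)) x) := by
  rw [onCompl, Valuation.comap_apply, ratFuncMap_algebraMap]
  rw [RatFunc.algebraMap_apply (R := FieldCompletion K), map_one, div_one,
    IsScalarTower.algebraMap_apply (CompletionBar K) (CompletionBar K)[X]
      (RatFunc (CompletionBar K)), Polynomial.algebraMap_apply (R := FieldCompletion K)]
  rfl

theorem baseDense_onCompl (v : Valuation (RatFunc (CompletionBar K)) Γ)
    (hv : (Valued.v : Valuation (FieldCompletion K) Γ₀).HasExtension v) :
    BaseDense K (onCompl v) := by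
  intro x δ hδ
  obtain ⟨c, hc⟩ := exists_completion_sub_lt x δ hδ
  refine ⟨c, ?_⟩
  rw [onCompl_algebraMap, onCompl_algebraMap]
  exact (Valuation.HasExtension.val_map_lt_iff _ v _ _).mpr hc

theorem baseCofinal_onCompl (v : Valuation (RatFunc (CompletionBar K)) Γ)
    (hv : (Valued.v : Valuation (FieldCompletion K) Γ₀).HasExtension v)
    (h : (IsValuationTranscendental K (onBase v) ∧ BaseCofinal K (onBase v)) ∨
        IsValuationAlgebraicTypeI v) : BaseCofinal (FieldCompletion K) (onCompl v) := by
  rcases h with ⟨ht, hu⟩ | ⟨-, ha⟩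
  · exact baseCofinal_of_isValuationTranscendental (baseDense_onCompl v hv) hu ht
  -- Of type I, only the absence of value transcendence over the completion is needed.
  · exact baseCofinal_of_rationalRank_ne_one _ fun h => ha (Or.inl h)

end Completed

end ValuedFieldExt

theorem theorem1p4 {K Γ₀ Γ : Type*} [Field K] [LinearOrderedCommGroupWithZero Γ₀] [Valued K Γ₀]
    [LinearOrderedCommGroupWithZero Γ]
    (v : Valuation (RatFunc (CompletionBar K)) Γ)
    (hv : (Valued.v : Valuation (FieldCompletion K) Γ₀).HasExtension v)
    (h : (IsValuationTranscendental K (onBase v) ∧ BaseCofinal K (onBase v)) ∨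
        IsValuationAlgebraicTypeI v) :
    (∀ α ∈ valGroup (onCompl v), ∀ f g : (FieldCompletion K)[X], ∃ f' g' : K[X],
        f.degree = f'.degree ∧ g.degree = g'.degree ∧
        onCompl v (ofComplPoly f) = onCompl v (ofPoly f') ∧
        onCompl v (ofComplPoly g) = onCompl v (ofPoly g') ∧
        onCompl v (ofComplPoly f - ofPoly f') < α ∧
        onCompl v (ofComplPoly g - ofPoly g') < α ∧
        (g ≠ 0 → onCompl v (ofComplPoly f / ofComplPoly g - ofPoly f' / ofPoly g') < α)) ∧
    IsDenseIn (onCompl v) (Set.range (ofPoly (K := K))) (Set.range (ofComplPoly (K := K))) ∧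
    IsDenseIn (onCompl v) (Set.range (ratFuncMap K (FieldCompletion K))) Set.univ := by
  have hd := baseDense_onCompl v hv
  have hcof := baseCofinal_onCompl v hv h
  have hpair := fun f g {y} (hy : y ≠ 0) => exists_polynomial_pair_approx hd hcof f g hy
  refine ⟨fun α hα f g => ?_, ?_, ?_⟩
  · obtain ⟨y, hy, e⟩ := (mem_valGroup_iff _ α).mp hα
    rw [← e]
    exact hpair f g hy
  · rintro _ ⟨f, rfl⟩ α hα
    obtain ⟨y, hy, e⟩ := (mem_valGroup_iff _ α).mp hα
    obtain ⟨f', -, -, -, -, -, hlt, -⟩ := hpair f 0 hy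
    refine ⟨_, ⟨f', rfl⟩, lt_of_lt_of_eq hlt e⟩
  · rintro r - α hα
    obtain ⟨y, hy, e⟩ := (mem_valGroup_iff _ α).mp hα
    -- The reduced fraction supplies the pair, with nonzero denominator.
    obtain ⟨f', g', -, -, -, -, -, -, hlt⟩ := hpair r.num r.denom hy
    refine ⟨_, ⟨algebraMap K[X] _ f' / algebraMap K[X] _ g', rfl⟩, ?_⟩
    rw [map_div₀, ratFuncMap_algebraMap_polynomial, ratFuncMap_algebraMap_polynomial]
    have := hlt r.denom_ne_zero
    rw [RatFunc.num_div_denom] at this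
    exact lt_of_lt_of_eq this e
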